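/- Let $m\ge 1$ be an integer. For an integer $q\ge 1$ write $\mathbb{Z}_q=\mathbb{Z}/q\mathbb{Z}$ and $T=q-2m$. Let $\mathcal{C}_m$ be the type C Shi arrangement, consisting of the hyperplanes $\{2x_i=0\}$, $\{2x_i=1\}$ for $1\le i\le m$ and $\{x_i\pm x_j=0\}$, $\{x_i\pm x_j=1\}$ for $1\le i<j\le m$. For $H\in\mathcal{C}_m$, let $H[q]\subseteq\mathbb{Z}_q^m$ be the solution set of the equation of $H$ over $\mathbb{Z}_q$, and let $$M\big((\mathcal{C}_m^{H})_q\big)=H[q]\setminus\bigcup_{K\in\mathcal{C}_m,\ K\neq H}\big(H[q]\cap K[q]\big)$$ be the complement of the restriction of $\mathcal{C}_m$ to $H$ modulo $q$. A function $f$ of $q$ is a quasi-polynomial with period $\rho\ge 1$ if on each residue class modulo $\rho$ it is given by a polynomial in $q$ with integer coefficients. The characteristic quasi-polynomial of $\mathcal{C}_m^H$ is the quasi-polynomial that agrees with $|M((\mathcal{C}_m^H)_q)|$ for all sufficiently large $q$. Then for each $H\in\mathcal{C}_m$ the characteristic quasi-polynomial of $\mathcal{C}_m^H$ exists, has period $2$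 (and even period $1$, i.e. is a polynomial, if $H=\{x_i-x_j=0\}$ or $H=\{x_i-x_j=1\}$), and is given by the following formulas, which hold for all sufficiently large $q$. For $1\le i\le m$: $$\left|M\big((\mathcal{C}_m^{\{2x_i=0\}})_q\big)\right|=\begin{cases}T^{m-i}(T+1)^{i-1}& q\text{ odd},\\ 2T^{m-i}(T+1)^{i-1}& q\text{ even};\end{cases}$$ $$\left|M\big((\mathcal{C}_m^{\{2x_i=1\}})_q\big)\right|=\begin{cases}T^{i-1}(T+1)^{m-i}& q\text{ odd},\\ 0& q\text{ even}.\end{cases}$$ For $1\le i<j\le m$: $$\left|M\big((\mathcal{C}_m^{\{x_i-x_j=0\}})_q\big)\right|=(T+1)^{j-i-1}(T+2)^{m-j+i};$$ $$\left|M\big((\mathcal{C}_m^{\{x_i-x_j=1\}})_q\big)\right|=T^{m-j+i}(T+1)^{j-i-1};$$ $$\left|M\big((\mathcal{C}_m^{\{x_i+x_j=0\}})_q\big)\right|=\begin{cases}T^{m-j}(T+1)^{j-i}(T+2)^{i-1}& q\text{ odd},\\ T^{m-j}(T+1)^{j-i-1}(T+2)^{i}& q\text{ even};\end{cases}$$ $$\left|M\big((\mathcal{C}_m^{\{x_i+x_j=1\}})_q\big)\right|=\begin{cases}T^{i-1}(T+1)^{j-i}(T+2)^{m-j}&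 q\text{ odd},\\ T^{i}(T+1)^{j-i-1}(T+2)^{m-j}& q\text{ even}.\end{cases}$$ Here "has period $\rho$" does not assert that $\rho$ is the minimal period. -/

import Mathlib

open Filter

/-- An integral affine hyperplane `{a₁ x₁ + ⋯ + a_m x_m = b}`, given by its integer coefficient
vector `a` and its integer constant term `b`.  A finite set of these is the data of an integer
matrix (the columns are the coefficient vectors) together with an integral vector. -/
@[ext]
structure IntHyperplane (m : ℕ) where
  coeff : Fin m → ℤ
  const : ℤ

namespace IntHyperplane

variable {m : ℕ}

/-- The `q`-reduction `H[q]`, as a subset of `(ℤ/qℤ)^m`. -/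
def reduction (H : IntHyperplane m) (q : ℕ) : Set (Fin m → ZMod q) :=
  {x | ∑ k, (H.coeff k : ZMod q) * x k = (H.const : ZMod q)}

/-- The hyperplane `{2 x_i = b}`. -/
def double (i : Fin m) (b : ℤ) : IntHyperplane m := ⟨Pi.single i 2, b⟩

/-- The hyperplane `{x_i - x_j = b}`. -/
def diff (i j : Fin m) (b : ℤ) : IntHyperplane m := ⟨Pi.single i 1 - Pi.single j 1, b⟩

/-- The hyperplane `{x_i + x_j = b}`. -/
def sum (i j : Fin m) (b : ℤ) : IntHyperplane m := ⟨Pi.single i 1 + Pi.single j 1, b⟩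

end IntHyperplane

/-- The Shi arrangement of type C: the hyperplanes `2 x_i = 0`, `2 x_i = 1` for all `i`, and
`x_i ± x_j = 0`, `x_i ± x_j = 1` for `i < j`. -/
def shiC (m : ℕ) : Set (IntHyperplane m) :=
  {K | ∃ i : Fin m, K = .double i 0 ∨ K = .double i 1} ∪
  {K | ∃ i j : Fin m, i < j ∧
    (K = .diff i j 0 ∨ K = .diff i j 1 ∨ K = .sum i j 0 ∨ K = .sum i j 1)}

/-- The `q`-reduction of the restriction `A^H` of `A` to `H`: the family of the sets
`H[q] ∩ K[q]`, where `K` runs over the members of `A` other than `H`. -/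
def restrictionReduction {m : ℕ} (A : Set (IntHyperplane m)) (H : IntHyperplane m) (q : ℕ) :
    Set (Set (Fin m → ZMod q)) :=
  (fun K => H.reduction q ∩ K.reduction q) '' (A \ {H})

/-- The complement `M((A^H)_q)`: the points of `H[q]` that lie in no member of the `q`-reduction
of the restriction `A^H`. -/
def restrictionComplement {m : ℕ} (A : Set (IntHyperplane m)) (H : IntHyperplane m) (q : ℕ) :
    Set (Fin m → ZMod q) :=
  H.reduction q \ ⋃₀ restrictionReduction A H q

/-- `f` is a quasi-polynomial having `ρ` as a (not necessarily minimal) period: on each residue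
class modulo `ρ` it is given by a polynomial. -/
def IsQuasiPolynomial (ρ : ℕ) (f : ℕ → ℤ) : Prop :=
  0 < ρ ∧ ∃ P : ℕ → Polynomial ℤ, ∀ q : ℕ, f q = (P (q % ρ)).eval (q : ℤ)

/-- `f` is the characteristic quasi-polynomial of the restriction `A^H`, and `ρ` is a period of it:
`f` is a quasi-polynomial with period `ρ`, and `|M((A^H)_q)| = f q` for all sufficiently
large `q`. -/
def IsRestrictionCharQuasiPolynomial {m : ℕ} (A : Set (IntHyperplane m)) (H : IntHyperplane m)
    (ρ : ℕ) (f : ℕ → ℤ) : Prop :=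
  IsQuasiPolynomial ρ f ∧ ∀ᶠ q : ℕ in atTop, ((restrictionComplement A H q).ncard : ℤ) = f q

/-- The label in `{1, …, m}` of a coordinate (`Fin m` counts from `0`). -/
def label {m : ℕ} (i : Fin m) : ℕ := (i : ℕ) + 1

/-!
A point of `(ℤ/qℤ)^m` is read as a placement of the signed labels `±1, …, ±m` on a cycle of `q`
cells: `k` in the cell `x_k` and `-k` in the opposite cell `-x_k`.  In the linear order
`1 < 2 < ⋯ < m < -m < ⋯ < -1` the Shi hyperplanes of type C say that two signed labels share a cell,
or that a cell and the next one hold signed labels in decreasing order.  The points of the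
complement of a restriction to `H` are thus the placements in which exactly those coincidences and
descents occur that belong to `H` (`restrictionComplement_shiC`).

Such a placement is built by inserting the labels not involved in `H` one at a time.  Removing `±k`
together with their cells turns a placement of `s + 1` labels on `q + 2` cells into one of `s`
labels on `q` cells, and transitivity of the order shows that no coincidence or descent is created or
destroyed.  Conversely `k` may be inserted between the cells `p` and `p + 1` if and only if `p`
holds no signed label above `k` and `p + 1` holds none below `k` (`ncard_isConfig_insert`).  Each signed
label other than `±k` blocks one slot, namely the slot after it if it is above `k` and the slot
before it if it is below `k`; so `q - 2 s` slots remain, plus one for each pair of signed labels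
that block the same slot.  Two signed labels do so only if they share a cell, or if a descent
crosses `k`, that is, only because of `H`; the number of these coincidences is `0`, `1` or `2` depending on
whether `k` comes before, between or after the labels of `H` (`IsConfigOn.ncard_isFreeSlot`).

The number `T = q - 2 s` does not change during the insertion, so the count is the number of
placements of the labels of `H` alone times a product of factors `T`, `T + 1`, `T + 2`
(`ncard_restrictionComplement_shiC`).  The dependence on the parity of `q` comes only from the
labels of `H`, through the solutions of `2 v = c` in `ℤ/qℤ`.
-/

/-! ### Equations in `ℤ/qℤ` in terms of representatives -/

section Representatives

variable {q : ℕ} [NeZero q]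

theorem ZMod.eq_iff_val_eq (u v : ZMod q) : u = v ↔ u.val = v.val :=
  (ZMod.val_injective q).eq_iff.symm

theorem ZMod.eq_add_one_iff_val (u v : ZMod q) :
    u = v + 1 ↔ u.val = v.val + 1 ∨ (u.val = 0 ∧ v.val + 1 = q) := by
  have hu := u.val_lt
  have hv := v.val_lt
  have h : u = v + 1 ↔ ((u.val : ℕ) : ZMod q) = ((v.val + 1 : ℕ) : ZMod q) := by simp
  rw [h, ZMod.natCast_eq_natCast_iff, Nat.ModEq, Nat.mod_eq_of_lt hu]
  rcases Nat.lt_or_ge (v.val + 1) q with h1 | h1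
  · rw [Nat.mod_eq_of_lt h1]; omega
  · have h2 : v.val + 1 = q := by omega
    rw [h2, Nat.mod_self]; omega

theorem ZMod.add_eq_zero_iff_val (u v : ZMod q) :
    u + v = 0 ↔ u.val + v.val = 0 ∨ u.val + v.val = q := by
  have hu := u.val_lt
  have hv := v.val_lt
  have h : u + v = 0 ↔ ((u.val + v.val : ℕ) : ZMod q) = ((0 : ℕ) : ZMod q) := by simp
  rw [h, ZMod.natCast_eq_natCast_iff, Nat.ModEq, Nat.zero_mod]
  rcases Nat.lt_or_ge (u.val + v.val) q with h1 | h1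
  · rw [Nat.mod_eq_of_lt h1]; omega
  · rw [Nat.mod_eq_sub_mod h1, Nat.mod_eq_of_lt (by omega)]; omega

theorem ZMod.add_eq_one_iff_val (hq : 2 ≤ q) (u v : ZMod q) :
    u + v = 1 ↔ u.val + v.val = 1 ∨ u.val + v.val = q + 1 := by
  have hu := u.val_lt
  have hv := v.val_lt
  have h : u + v = 1 ↔ ((u.val + v.val : ℕ) : ZMod q) = ((1 : ℕ) : ZMod q) := by simp
  rw [h, ZMod.natCast_eq_natCast_iff, Nat.ModEq, Nat.mod_eq_of_lt (show 1 < q by omega)]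
  rcases Nat.lt_or_ge (u.val + v.val) q with h1 | h1
  · rw [Nat.mod_eq_of_lt h1]; omega
  · rw [Nat.mod_eq_sub_mod h1, Nat.mod_eq_of_lt (by omega)]; omega

end Representatives

/-! ### Opening two opposite slots of the cycle `ℤ/qℤ` -/

section Widen

variable {q : ℕ}

/-- The symmetric embedding of the cycle `ℤ/qℤ` into `ℤ/(q+2)ℤ` that opens one new cell between
`p` and `p + 1` and another one between `-p - 1` and `-p`.  If these two slots coincide, both new
cells are opened there.  On representatives in `0, …, q - 1`, the opposite slot is the one after
`q - 1 - p`, and `z` moves up by the number of the two slots that lie below it. -/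
def widen (p z : ZMod q) : ZMod (q + 2) :=
  ((z.val + (if p.val < z.val then 1 else 0) + (if q ≤ p.val + z.val then 1 else 0) : ℕ) :
    ZMod (q + 2))

/-- The new cell that `widen p` opens between `p` and `p + 1`; if both new cells lie there, it is
the one next to `p`.  The other new cell is its negative. -/
def newCell (p : ZMod q) : ZMod (q + 2) :=
  ((p.val + 1 + (if q ≤ 2 * p.val then 1 else 0) : ℕ) : ZMod (q + 2))

variable [NeZero q]

theorem val_widen (p z : ZMod q) :
    (p.val < z.val ∧ q ≤ p.val + z.val ∧ (widen p z).val = z.val + 2) ∨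
    (p.val < z.val ∧ p.val + z.val < q ∧ (widen p z).val = z.val + 1) ∨
    (z.val ≤ p.val ∧ q ≤ p.val + z.val ∧ (widen p z).val = z.val + 1) ∨
    (z.val ≤ p.val ∧ p.val + z.val < q ∧ (widen p z).val = z.val) := by
  have := z.val_lt
  have h : (widen p z).val =
      z.val + (if p.val < z.val then 1 else 0) + (if q ≤ p.val + z.val then 1 else 0) :=
    ZMod.val_cast_of_lt (by split_ifs <;> omega)
  split_ifs at h <;> omega

theorem val_newCell (p : ZMod q) :
    (q ≤ 2 * p.val ∧ (newCell p).val = p.val + 2) ∨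
    (2 * p.val < q ∧ (newCell p).val = p.val + 1) := by
  have := p.val_lt
  have h : (newCell p).val = p.val + 1 + (if q ≤ 2 * p.val then 1 else 0) :=
    ZMod.val_cast_of_lt (by split_ifs <;> omega)
  split_ifs at h <;> omega

theorem widen_zero (p : ZMod q) : widen p 0 = 0 := by
  have := p.val_lt
  rw [ZMod.eq_iff_val_eq]
  have ha := val_widen p 0
  rw [ZMod.val_zero] at ha ⊢
  omega

theorem widen_inj (p u v : ZMod q) : widen p u = widen p v ↔ u = v := by
  rw [ZMod.eq_iff_val_eq, ZMod.eq_iff_val_eq]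
  have ha := val_widen p u
  have hb := val_widen p v
  omega

theorem widen_add_eq_zero (p u v : ZMod q) : widen p u + widen p v = 0 ↔ u + v = 0 := by
  have hu := u.val_lt
  have hv := v.val_lt
  have hp := p.val_lt
  rw [ZMod.add_eq_zero_iff_val, ZMod.add_eq_zero_iff_val]
  have ha := val_widen p u
  have hb := val_widen p v
  omega

theorem widen_eq_add_one {p u v : ZMod q} (h₁ : ¬(v = p ∧ u = p + 1)) (h₂ : u + p ≠ 0) :
    widen p u = widen p v + 1 ↔ u = v + 1 := by
  have hu := u.val_lt
  have hv := v.val_lt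
  have hp := p.val_lt
  rw [ZMod.eq_iff_val_eq, ZMod.eq_add_one_iff_val] at h₁
  rw [Ne, ZMod.add_eq_zero_iff_val] at h₂
  rw [ZMod.eq_add_one_iff_val, ZMod.eq_add_one_iff_val]
  have ha := val_widen p u
  have hb := val_widen p v
  omega

theorem widen_add_eq_one (hq : 2 ≤ q) {p u v : ZMod q} (h₁ : u + p ≠ 0) (h₂ : v + p ≠ 0) :
    widen p u + widen p v = 1 ↔ u + v = 1 := by
  have hu := u.val_lt
  have hv := v.val_lt
  have hp := p.val_lt
  rw [Ne, ZMod.add_eq_zero_iff_val] at h₁ h₂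
  rw [ZMod.add_eq_one_iff_val (by omega), ZMod.add_eq_one_iff_val hq]
  have ha := val_widen p u
  have hb := val_widen p v
  omega

theorem widen_ne_newCell (p z : ZMod q) : widen p z ≠ newCell p := by
  have hz := z.val_lt
  have hp := p.val_lt
  rw [Ne, ZMod.eq_iff_val_eq]
  have ha := val_widen p z
  have hb := val_newCell p
  omega

theorem widen_add_newCell_ne_zero (p z : ZMod q) : widen p z + newCell p ≠ 0 := by
  have hz := z.val_lt
  have hp := p.val_lt
  rw [Ne, ZMod.add_eq_zero_iff_val]
  have ha := val_widen p z
  have hb := val_newCell p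
  omega

theorem newCell_add_self_ne_zero (p : ZMod q) : newCell p + newCell p ≠ 0 := by
  have hp := p.val_lt
  rw [Ne, ZMod.add_eq_zero_iff_val]
  have ha := val_newCell p
  omega

theorem newCell_add_self_ne_one (p : ZMod q) : newCell p + newCell p ≠ 1 := by
  have hp := p.val_lt
  rw [Ne, ZMod.add_eq_one_iff_val (by omega)]
  have ha := val_newCell p
  omega

theorem newCell_eq_widen_add_one (p z : ZMod q) : newCell p = widen p z + 1 ↔ z = p := by
  have hz := z.val_lt
  have hp := p.val_lt
  rw [ZMod.eq_add_one_iff_val, ZMod.eq_iff_val_eq]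
  have ha := val_widen p z
  have hb := val_newCell p
  omega

theorem widen_eq_newCell_add_one {p z : ZMod q} (h : z + p ≠ 0) :
    widen p z = newCell p + 1 ↔ z = p + 1 := by
  have hz := z.val_lt
  have hp := p.val_lt
  rw [Ne, ZMod.add_eq_zero_iff_val] at h
  rw [ZMod.eq_add_one_iff_val, ZMod.eq_add_one_iff_val]
  have ha := val_widen p z
  have hb := val_newCell p
  omega

theorem widen_add_newCell_eq_one (p z : ZMod q) :
    widen p z + newCell p = 1 ↔ z + p = 0 := by
  have hz := z.val_lt
  have hp := p.val_lt
  rw [ZMod.add_eq_one_iff_val (by omega), ZMod.add_eq_zero_iff_val]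
  have ha := val_widen p z
  have hb := val_newCell p
  omega

theorem newCell_injective : Function.Injective (newCell : ZMod q → ZMod (q + 2)) := by
  intro p r h
  have hp := p.val_lt
  have hr := r.val_lt
  rw [ZMod.eq_iff_val_eq] at h
  rw [ZMod.eq_iff_val_eq]
  have ha := val_newCell p
  have hb := val_newCell r
  omega

theorem exists_newCell_eq {y : ZMod (q + 2)} (h₀ : y + y ≠ 0) (h₁ : y + y ≠ 1) :
    ∃ p : ZMod q, newCell p = y := by
  have hy := y.val_lt
  rw [Ne, ZMod.add_eq_zero_iff_val] at h₀
  rw [Ne, ZMod.add_eq_one_iff_val (by omega)] at h₁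
  have hq : q ≠ 0 := NeZero.ne q
  -- Subtract from `y` the number of new cells up to `y`.
  obtain ⟨n, hn, h⟩ : ∃ n < q, (q ≤ 2 * n ∧ y.val = n + 2) ∨ (2 * n < q ∧ y.val = n + 1) := by
    rcases Nat.lt_or_ge (q + 1) (2 * y.val) with h | h
    · exact ⟨y.val - 2, by omega⟩
    · exact ⟨y.val - 1, by omega⟩
  refine ⟨n, ?_⟩
  have ha := val_newCell (n : ZMod q)
  rw [ZMod.val_cast_of_lt hn] at ha
  rw [ZMod.eq_iff_val_eq]
  omega

theorem exists_widen_eq {p : ZMod q} {y : ZMod (q + 2)} (h₀ : y ≠ newCell p)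
    (h₁ : y + newCell p ≠ 0) : ∃ z : ZMod q, widen p z = y := by
  have hy := y.val_lt
  have hp := p.val_lt
  rw [Ne, ZMod.eq_iff_val_eq] at h₀
  rw [Ne, ZMod.add_eq_zero_iff_val] at h₁
  have ha := val_newCell p
  -- Subtract from `y` the number of new cells below `y`.
  obtain ⟨n, hn, h⟩ : ∃ n < q, (p.val < n ∧ q ≤ p.val + n ∧ y.val = n + 2) ∨
      (p.val < n ∧ p.val + n < q ∧ y.val = n + 1) ∨
      (n ≤ p.val ∧ q ≤ p.val + n ∧ y.val = n + 1) ∨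
      (n ≤ p.val ∧ p.val + n < q ∧ y.val = n) := by
    by_cases h2 : p.val + 1 < y.val ∧ q + 1 < p.val + y.val
    · exact ⟨y.val - 2, by omega⟩
    by_cases h3 : p.val + 1 < y.val ∨ q < p.val + y.val
    · exact ⟨y.val - 1, by omega⟩
    · exact ⟨y.val, by omega⟩
  refine ⟨n, ?_⟩
  have hb := val_widen p (n : ZMod q)
  rw [ZMod.val_cast_of_lt hn] at hb
  rw [ZMod.eq_iff_val_eq]
  omega

end Widen

/-! ### Points lying on prescribed Shi hyperplanes -/

/-- The four families of hyperplanes of the type C Shi arrangement: `x_a - x_b = 0`,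
`x_a - x_b = 1`, `x_a + x_b = 0` and `x_a + x_b = 1`.  The hyperplanes `2 x_a = 0` and `2 x_a = 1`
are the members of the last two families with `a = b`. -/
inductive ShiKind
  | diffZero
  | diffOne
  | sumZero
  | sumOne

namespace ShiKind

/-- The pairs of labels that index the hyperplanes of a family: `a < b` for the differences,
`a ≤ b` for the sums. -/
def Admissible {ι : Type*} [LinearOrder ι] : ShiKind → ι → ι → Prop
  | diffZero, a, b => a < b
  | diffOne, a, b => a < b
  | sumZero, a, b => a ≤ b
  | sumOne, a, b => a ≤ b

theorem Admissible.of_lt {ι : Type*} [LinearOrder ι] {a b : ι} (h : a < b) :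
    ∀ κ : ShiKind, κ.Admissible a b
  | diffZero => h
  | diffOne => h
  | sumZero => h.le
  | sumOne => h.le

theorem Admissible.lt_of_ne {ι : Type*} [LinearOrder ι] {a b : ι} :
    ∀ {κ : ShiKind}, κ.Admissible a b → a ≠ b → a < b
  | diffZero, h, _ => h
  | diffOne, h, _ => h
  | sumZero, h, hne => _root_.lt_of_le_of_ne h hne
  | sumOne, h, hne => _root_.lt_of_le_of_ne h hne

/-- The equation of a family, for the values `u` of `x_a` and `v` of `x_b`. -/
def Holds {q : ℕ} : ShiKind → ZMod q → ZMod q → Prop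
  | diffZero, u, v => u = v
  | diffOne, u, v => u = v + 1
  | sumZero, u, v => u + v = 0
  | sumOne, u, v => u + v = 1

end ShiKind

section Insertion

variable {ι : Type*} [LinearOrder ι] {q : ℕ}

/-- The points `x` of `(ℤ/qℤ)^S` (extended by zero to all labels) that lie on the hyperplanes
selected by `F`, and on no other Shi hyperplane with labels in `S`. -/
def IsConfig (F : ShiKind → ι → ι → Prop) (S : Finset ι) (x : ι → ZMod q) : Prop :=
  (∀ a, a ∉ S → x a = 0) ∧
    ∀ κ a b, a ∈ S → b ∈ S → ShiKind.Admissible κ a b → (κ.Holds (x a) (x b) ↔ F κ a b)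

/-- The slot between `p` and `p + 1` is free for the label `k`: the cell `p` holds no signed label
above `k`, and `p + 1` holds no label below `k`, in the order `1 < 2 < ⋯ < m < -m < ⋯ < -1`. -/
def IsFreeSlot (S : Finset ι) (k : ι) (x : ι → ZMod q) (p : ZMod q) : Prop :=
  (∀ a ∈ S, k < a → x a ≠ p) ∧ (∀ a ∈ S, x a + p ≠ 0) ∧ ∀ a ∈ S, a < k → x a ≠ p + 1

/-- Insert the label `k` into the slot after `p`, and its negative into the opposite slot. -/
def insertLabel (k : ι) (x : ι → ZMod q) (p : ZMod q) : ι → ZMod (q + 2) :=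
  Function.update (fun a => widen p (x a)) k (newCell p)

variable {F : ShiKind → ι → ι → Prop} {S : Finset ι} {k : ι}

theorem insertLabel_self (x : ι → ZMod q) (p : ZMod q) : insertLabel k x p k = newCell p :=
  Function.update_self ..

theorem insertLabel_of_ne (x : ι → ZMod q) (p : ZMod q) {a : ι} (h : a ≠ k) :
    insertLabel k x p a = widen p (x a) :=
  Function.update_of_ne h ..

variable [NeZero q]

/-- Widening at a free slot changes no incidence with a Shi hyperplane: the signed labels in the two
cells next to the slot are in increasing order, so their adjacency lies on no hyperplane. -/
theorem IsFreeSlot.holds_widen_iff (hq : 2 ≤ q) {x : ι → ZMod q} {p : ZMod q}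
    (hp : IsFreeSlot S k x p) (hk : k ∉ S) {κ : ShiKind} {a b : ι} (ha : a ∈ S) (hb : b ∈ S)
    (hab : κ.Admissible a b) :
    κ.Holds (widen p (x a)) (widen p (x b)) ↔ κ.Holds (x a) (x b) := by
  cases κ with
  | diffZero => exact widen_inj p _ _
  | diffOne =>
    refine widen_eq_add_one ?_ (hp.2.1 a ha)
    rintro ⟨h₁, h₂⟩
    rcases lt_trichotomy k b with h | h | h
    · exact hp.1 b hb h h₁
    · exact hk (h ▸ hb)
    · exact hp.2.2 a ha (lt_trans hab h) h₂
  | sumZero => exact widen_add_eq_zero p _ _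
  | sumOne => exact widen_add_eq_one hq (hp.2.1 a ha) (hp.2.1 b hb)

/-- Conversely, a slot is free if no hyperplane involving the new label contains the new point. -/
theorem isFreeSlot_of_not_holds {x : ι → ZMod q} {p : ZMod q}
    (hlt : ∀ a ∈ S, a < k → ∀ κ : ShiKind, ¬κ.Holds (widen p (x a)) (newCell p))
    (hgt : ∀ a ∈ S, k < a → ∀ κ : ShiKind, ¬κ.Holds (newCell p) (widen p (x a)))
    (hk : k ∉ S) : IsFreeSlot S k x p := by
  have hneg : ∀ a ∈ S, x a + p ≠ 0 := by
    intro a ha h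
    rw [← widen_add_newCell_eq_one] at h
    rcases lt_trichotomy a k with h' | h' | h'
    · exact hlt a ha h' .sumOne h
    · exact hk (h' ▸ ha)
    · exact hgt a ha h' .sumOne ((add_comm _ _).trans h)
  refine ⟨fun a ha h h' => ?_, hneg, fun a ha h h' => ?_⟩
  · exact hgt a ha h .diffOne ((newCell_eq_widen_add_one p _).2 h')
  · exact hlt a ha h .diffOne ((widen_eq_newCell_add_one (hneg a ha)).2 h')

theorem IsFreeSlot.not_holds_lt {x : ι → ZMod q} {p : ZMod q} (hp : IsFreeSlot S k x p) {a : ι}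
    (ha : a ∈ S) (h : a < k) (κ : ShiKind) : ¬κ.Holds (widen p (x a)) (newCell p) := by
  cases κ with
  | diffZero => exact widen_ne_newCell p _
  | diffOne =>
    exact fun h' => hp.2.2 a ha h ((widen_eq_newCell_add_one (hp.2.1 a ha)).1 h')
  | sumZero => exact widen_add_newCell_ne_zero p _
  | sumOne => exact fun h' => hp.2.1 a ha ((widen_add_newCell_eq_one p _).1 h')

theorem IsFreeSlot.not_holds_gt {x : ι → ZMod q} {p : ZMod q} (hp : IsFreeSlot S k x p) {a : ι}
    (ha : a ∈ S) (h : k < a) (κ : ShiKind) : ¬κ.Holds (newCell p) (widen p (x a)) := by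
  cases κ with
  | diffZero => exact (widen_ne_newCell p _).symm
  | diffOne => exact fun h' => hp.1 a ha h ((newCell_eq_widen_add_one p _).1 h')
  | sumZero => exact fun h' => widen_add_newCell_ne_zero p _ ((add_comm _ _).trans h')
  | sumOne =>
    exact fun h' => hp.2.1 a ha ((widen_add_newCell_eq_one p _).1 ((add_comm _ _).trans h'))

theorem isConfig_insertLabel (hq : 2 ≤ q) (hk : k ∉ S)
    (hF : ∀ κ a b, F κ a b → a ≠ k ∧ b ≠ k) {x : ι → ZMod q} (hx : IsConfig F S x) {p : ZMod q}
    (hp : IsFreeSlot S k x p) : IsConfig F (insert k S) (insertLabel k x p) := by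
  have hne : ∀ a ∈ S, a ≠ k := fun a ha h => hk (h ▸ ha)
  refine ⟨fun a ha => ?_, fun κ a b ha hb hab => ?_⟩
  · rw [Finset.mem_insert, not_or] at ha
    rw [insertLabel_of_ne x p ha.1, hx.1 a ha.2, widen_zero]
  rcases Finset.mem_insert.1 ha with rfl | haS <;> rcases Finset.mem_insert.1 hb with rfl | hbS
  · refine iff_of_false ?_ fun h => (hF _ _ _ h).1 rfl
    rw [insertLabel_self]
    cases κ with
    | diffZero => exact absurd hab (lt_irrefl _)
    | diffOne => exact absurd hab (lt_irrefl _)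
    | sumZero => exact newCell_add_self_ne_zero p
    | sumOne => exact newCell_add_self_ne_one p
  · refine iff_of_false ?_ fun h => (hF _ _ _ h).1 rfl
    rw [insertLabel_self, insertLabel_of_ne x p (hne b hbS)]
    exact hp.not_holds_gt hbS (hab.lt_of_ne (hne b hbS).symm) κ
  · refine iff_of_false ?_ fun h => (hF _ _ _ h).2 rfl
    rw [insertLabel_self, insertLabel_of_ne x p (hne a haS)]
    exact hp.not_holds_lt haS (hab.lt_of_ne (hne a haS)) κ
  · rw [insertLabel_of_ne x p (hne a haS), insertLabel_of_ne x p (hne b hbS),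
      hp.holds_widen_iff hq hk haS hbS hab, hx.2 κ a b haS hbS hab]

theorem insertLabel_injective (hk : k ∉ S) {x x' : ι → ZMod q} (hx : IsConfig F S x)
    (hx' : IsConfig F S x') {p p' : ZMod q} (h : insertLabel k x p = insertLabel k x' p') :
    x = x' ∧ p = p' := by
  have hp : p = p' := by
    have := congrFun h k
    rw [insertLabel_self, insertLabel_self] at this
    exact newCell_injective this
  subst hp
  refine ⟨funext fun a => ?_, rfl⟩
  by_cases ha : a = k
  · rw [ha, hx.1 k hk, hx'.1 k hk]
  · have := congrFun h a
    rwa [insertLabel_of_ne _ _ ha, insertLabel_of_ne _ _ ha, widen_inj] at this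

theorem IsConfig.exists_insertLabel (hq : 2 ≤ q) (hk : k ∉ S)
    (hF : ∀ κ a b, F κ a b → a ≠ k ∧ b ≠ k) {y : ι → ZMod (q + 2)}
    (hy : IsConfig F (insert k S) y) :
    ∃ x p, IsConfig F S x ∧ IsFreeSlot S k x p ∧ insertLabel k x p = y := by
  have hne : ∀ a ∈ S, a ≠ k := fun a ha h => hk (h ▸ ha)
  have hkS := Finset.mem_insert_self k S
  have hlt : ∀ a ∈ S, a < k → ∀ κ : ShiKind, ¬κ.Holds (y a) (y k) := by
    intro a ha h κ h'
    exact (hF κ a k ((hy.2 κ a k (Finset.mem_insert_of_mem ha) hkS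
      (.of_lt h κ)).1 h')).2 rfl
  have hgt : ∀ a ∈ S, k < a → ∀ κ : ShiKind, ¬κ.Holds (y k) (y a) := by
    intro a ha h κ h'
    exact (hF κ k a ((hy.2 κ k a hkS (Finset.mem_insert_of_mem ha)
      (.of_lt h κ)).1 h')).1 rfl
  obtain ⟨p, hp⟩ : ∃ p : ZMod q, newCell p = y k :=
    exists_newCell_eq
      (fun h => (hF _ _ _ ((hy.2 .sumZero k k hkS hkS (le_refl k)).1 h)).1 rfl)
      (fun h => (hF _ _ _ ((hy.2 .sumOne k k hkS hkS (le_refl k)).1 h)).1 rfl)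
  have hex : ∀ a, ∃ z : ZMod q, (a ∉ S → z = 0) ∧ (a ∈ S → widen p z = y a) := by
    intro a
    by_cases ha : a ∈ S
    · obtain ⟨z, hz⟩ : ∃ z : ZMod q, widen p z = y a := by
        rcases lt_or_gt_of_ne (hne a ha) with h | h
        · exact exists_widen_eq (fun h' => hlt a ha h .diffZero (h'.trans hp))
            (fun h' => hlt a ha h .sumZero (by rw [← hp]; exact h'))
        · exact exists_widen_eq (fun h' => hgt a ha h .diffZero (hp.symm.trans h'.symm))
            (fun h' => hgt a ha h .sumZero (by rw [← hp]; exact (add_comm _ _).trans h'))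
      exact ⟨z, fun h => absurd ha h, fun _ => hz⟩
    · exact ⟨0, fun _ => rfl, fun h => absurd h ha⟩
  choose x hx₀ hx using hex
  have hfree : IsFreeSlot S k x p := by
    refine isFreeSlot_of_not_holds (fun a ha h κ => ?_) (fun a ha h κ => ?_) hk
    · rw [hx a ha, hp]; exact hlt a ha h κ
    · rw [hx a ha, hp]; exact hgt a ha h κ
  refine ⟨x, p, ⟨hx₀, fun κ a b ha hb hab => ?_⟩, hfree, funext fun a => ?_⟩
  · rw [← hfree.holds_widen_iff hq hk ha hb hab, hx a ha, hx b hb]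
    exact hy.2 κ a b (Finset.mem_insert_of_mem ha) (Finset.mem_insert_of_mem hb) hab
  · by_cases hak : a = k
    · rw [hak, insertLabel_self, hp]
    · rw [insertLabel_of_ne x p hak]
      by_cases ha : a ∈ S
      · exact hx a ha
      · rw [hx₀ a ha, widen_zero, hy.1 a (by simp [hak, ha])]

open Classical in
/-- If every configuration on `S` has `c` free slots for `k`, then inserting `k` multiplies the
number of configurations by `c`. -/
theorem ncard_isConfig_insert [Finite ι] (hq : 2 ≤ q) (hk : k ∉ S)
    (hF : ∀ κ a b, F κ a b → a ≠ k ∧ b ≠ k) {c : ℕ}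
    (hc : ∀ x : ι → ZMod q, IsConfig F S x → {p | IsFreeSlot S k x p}.ncard = c) :
    {y : ι → ZMod (q + 2) | IsConfig F (insert k S) y}.ncard =
      {x : ι → ZMod q | IsConfig F S x}.ncard * c := by
  have := Fintype.ofFinite ι
  have hbij : (((Finset.univ.filter fun x : ι → ZMod q => IsConfig F S x).sigma fun x =>
      Finset.univ.filter fun p => IsFreeSlot S k x p)).card =
      (Finset.univ.filter fun y : ι → ZMod (q + 2) => IsConfig F (insert k S) y).card := by
    refine Finset.card_bij (fun a _ => insertLabel k a.1 a.2) ?_ ?_ ?_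
    · rintro ⟨x, p⟩ h
      simp only [Finset.mem_sigma, Finset.mem_filter, Finset.mem_univ, true_and] at h ⊢
      exact isConfig_insertLabel hq hk hF h.1 h.2
    · rintro ⟨x, p⟩ h ⟨x', p'⟩ h' he
      simp only [Finset.mem_sigma, Finset.mem_filter, Finset.mem_univ, true_and] at h h'
      obtain ⟨rfl, rfl⟩ := insertLabel_injective hk h.1 h'.1 he
      rfl
    · intro y hy
      simp only [Finset.mem_filter, Finset.mem_univ, true_and] at hy
      obtain ⟨x, p, hx, hp, h⟩ := hy.exists_insertLabel hq hk hF
      exact ⟨⟨x, p⟩, by simp [hx, hp], h⟩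
  rw [Finset.card_sigma, Finset.sum_const_nat (m := c), ← Set.ncard_coe_finset,
    ← Set.ncard_coe_finset] at hbij
  · simpa using hbij.symm
  · intro x hx
    rw [← hc x (Finset.mem_filter.1 hx).2, ← Set.ncard_coe_finset]
    simp

end Insertion

/-! ### The number of free slots -/

section FreeSlots

variable {ι : Type*} [LinearOrder ι] {q : ℕ} {κ : ShiKind} {i j k : ι} {S : Finset ι}
  {x : ι → ZMod q}

/-- The points of `(ℤ/qℤ)^S` on the hyperplane of the family `κ` with labels `i`, `j`, and on no
other Shi hyperplane with labels in `S`. -/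
def IsConfigOn (κ : ShiKind) (i j : ι) (S : Finset ι) (x : ι → ZMod q) : Prop :=
  IsConfig (fun κ' a b => κ' = κ ∧ a = i ∧ b = j) S x

/-- The number of free slots for `k` in a configuration of `s` labels in `ℤ/qℤ` lying on the
hyperplane of the family `κ` with labels `i`, `j`, minus `q - 2 s`. -/
def slotExcess (κ : ShiKind) (i j k : ι) : ℕ :=
  match κ with
  | .diffZero => if i < k ∧ k < j then 1 else 2
  | .diffOne => if i < k ∧ k < j then 1 else 0
  | .sumZero => (({i, j} : Finset ι).filter fun a => k < a).card
  | .sumOne => (({i, j} : Finset ι).filter fun a => a < k).card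

namespace IsConfigOn

theorem eq_of_eq (hx : IsConfigOn κ i j S x) {a b : ι} (ha : a ∈ S) (hb : b ∈ S)
    (h : x a = x b) : a = b ∨ κ = .diffZero ∧ (a = i ∧ b = j ∨ a = j ∧ b = i) := by
  rcases lt_trichotomy a b with hab | hab | hab
  · obtain ⟨h₁, h₂⟩ := (hx.2 .diffZero a b ha hb hab).1 h
    exact .inr ⟨h₁.symm, .inl h₂⟩
  · exact .inl hab
  · obtain ⟨h₁, h₂⟩ := (hx.2 .diffZero b a hb ha hab).1 h.symm
    exact .inr ⟨h₁.symm, .inr h₂.symm⟩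

theorem eq_of_eq_add_one (hx : IsConfigOn κ i j S x) {a b : ι} (ha : a ∈ S) (hb : b ∈ S)
    (hab : a < b) (h : x a = x b + 1) : κ = .diffOne ∧ a = i ∧ b = j := by
  obtain ⟨h₁, h₂⟩ := (hx.2 .diffOne a b ha hb hab).1 h
  exact ⟨h₁.symm, h₂⟩

theorem eq_of_add_eq_zero (hx : IsConfigOn κ i j S x) {a b : ι} (ha : a ∈ S) (hb : b ∈ S)
    (h : x a + x b = 0) : κ = .sumZero ∧ (a = i ∧ b = j ∨ a = j ∧ b = i) := by
  rcases le_total a b with hab | hab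
  · obtain ⟨h₁, h₂⟩ := (hx.2 .sumZero a b ha hb hab).1 h
    exact ⟨h₁.symm, .inl h₂⟩
  · obtain ⟨h₁, h₂⟩ := (hx.2 .sumZero b a hb ha hab).1 ((add_comm _ _).trans h)
    exact ⟨h₁.symm, .inr h₂.symm⟩

theorem eq_of_add_eq_one (hx : IsConfigOn κ i j S x) {a b : ι} (ha : a ∈ S) (hb : b ∈ S)
    (h : x a + x b = 1) : κ = .sumOne ∧ (a = i ∧ b = j ∨ a = j ∧ b = i) := by
  rcases le_total a b with hab | hab
  · obtain ⟨h₁, h₂⟩ := (hx.2 .sumOne a b ha hb hab).1 h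
    exact ⟨h₁.symm, .inl h₂⟩
  · obtain ⟨h₁, h₂⟩ := (hx.2 .sumOne b a hb ha hab).1 ((add_comm _ _).trans h)
    exact ⟨h₁.symm, .inr h₂.symm⟩

theorem holds (hx : IsConfigOn κ i j S x) (hi : i ∈ S) (hj : j ∈ S) (hij : κ.Admissible i j) :
    κ.Holds (x i) (x j) :=
  (hx.2 κ i j hi hj hij).2 ⟨rfl, rfl, rfl⟩

end IsConfigOn

variable [NeZero q]

/-- The blocked slots are the values `x a` for `a > k`, the values `-x a`, and the values `x a - 1`
for `a < k`.  If `P`, `N`, `L` are sets of labels whose values of the three kinds are without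
repetition and exhaust the blocked slots, their cardinalities count the blocked slots. -/
theorem ncard_isFreeSlot_add {P N L : Finset ι} (hPS : P ⊆ S) (hNS : N ⊆ S) (hLS : L ⊆ S)
    (hP : ∀ a ∈ P, k < a) (hL : ∀ a ∈ L, a < k)
    (hPinj : Set.InjOn x P) (hNinj : Set.InjOn x N) (hLinj : Set.InjOn x L)
    (hPN : ∀ a ∈ P, ∀ b ∈ N, x a + x b ≠ 0) (hLP : ∀ a ∈ L, ∀ b ∈ P, x a ≠ x b + 1)
    (hLN : ∀ a ∈ L, ∀ b ∈ N, x a + x b ≠ 1)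
    (hPcov : ∀ a ∈ S, k < a → (∃ b ∈ P, x b = x a) ∨ ∃ b ∈ N, x a + x b = 0)
    (hNcov : ∀ a ∈ S, ∃ b ∈ N, x b = x a)
    (hLcov : ∀ a ∈ S, a < k →
      (∃ b ∈ L, x b = x a) ∨ (∃ b ∈ P, x a = x b + 1) ∨ ∃ b ∈ N, x a + x b = 1) :
    {p | IsFreeSlot S k x p}.ncard + (P.card + N.card + L.card) = q := by
  classical
  have hset : {p | IsFreeSlot S k x p}ᶜ =
      ((P.image x ∪ N.image (fun a => -x a) ∪ L.image (fun a => x a - 1) : Finset (ZMod q)) :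
        Set (ZMod q)) := by
    ext p
    simp only [Set.mem_compl_iff, Set.mem_ofPred_eq, Finset.coe_union, Finset.coe_image,
      Set.mem_union, Set.mem_image, Finset.mem_coe]
    constructor
    · intro h
      by_contra! h'
      obtain ⟨⟨h₁, h₂⟩, h₃⟩ := h'
      refine h ⟨fun a ha hka hp => ?_, fun a ha hp => ?_, fun a ha hka hp => ?_⟩
      · rcases hPcov a ha hka with ⟨b, hb, hba⟩ | ⟨b, hb, hba⟩
        · exact h₁ b hb (hba.trans hp)
        · exact h₂ b hb (by rw [← hp]; linear_combination -hba)
      · obtain ⟨b, hb, hba⟩ := hNcov a ha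
        exact h₂ b hb (by rw [hba]; linear_combination -hp)
      · rcases hLcov a ha hka with ⟨b, hb, hba⟩ | ⟨b, hb, hba⟩ | ⟨b, hb, hba⟩
        · exact h₃ b hb (by rw [hba, hp]; ring)
        · exact h₁ b hb (by linear_combination hp - hba)
        · exact h₂ b hb (by linear_combination hp - hba)
    · rintro ((⟨a, ha, rfl⟩ | ⟨a, ha, rfl⟩) | ⟨a, ha, rfl⟩) h
      · exact h.1 a (hPS ha) (hP a ha) rfl
      · exact h.2.1 a (hNS ha) (add_neg_cancel _)
      · exact h.2.2 a (hLS ha) (hL a ha) (sub_add_cancel _ _).symm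
  have hcard := Set.ncard_add_ncard_compl {p | IsFreeSlot S k x p}
  rw [hset, Set.ncard_coe_finset, Nat.card_zmod, Finset.card_union_of_disjoint,
    Finset.card_union_of_disjoint, Finset.card_image_of_injOn hPinj,
    Finset.card_image_of_injOn (f := fun a => -x a), Finset.card_image_of_injOn
    (f := fun a => x a - 1)] at hcard
  · exact hcard
  · exact fun a ha b hb h => hLinj ha hb (sub_left_injective h)
  · exact fun a ha b hb h => hNinj ha hb (neg_injective h)
  · simp only [Finset.disjoint_left, Finset.mem_image, not_exists, not_and]
    rintro _ ⟨a, ha, rfl⟩ b hb h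
    exact hPN a ha b hb (by linear_combination -h)
  · simp only [Finset.disjoint_left, Finset.mem_union, Finset.mem_image, not_exists, not_and]
    rintro _ (⟨a, ha, rfl⟩ | ⟨a, ha, rfl⟩) b hb h
    · exact hLP b hb a ha (by linear_combination h)
    · exact hLN b hb a ha (by linear_combination h)

omit [NeZero q] in
theorem card_filter_sdiff_add {E : Finset ι} (hE : E ⊆ S) (p : ι → Prop) [DecidablePred p] :
    ((S \ E).filter p).card + (E.filter p).card = (S.filter p).card := by
  rw [← Finset.card_union_of_disjoint
    (Finset.disjoint_filter_filter Finset.sdiff_disjoint), ← Finset.filter_union,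
    Finset.sdiff_union_of_subset hE]

/-- The blocked slots number `2 |S|`, except for the coincidences caused by the hyperplane through
the configuration. -/
theorem IsConfigOn.ncard_isFreeSlot (hx : IsConfigOn κ i j S x) (hi : i ∈ S) (hj : j ∈ S)
    (hij : κ.Admissible i j) (hk : k ∉ S) :
    {p | IsFreeSlot S k x p}.ncard + 2 * S.card = q + slotExcess κ i j k := by
  have hne : ∀ a ∈ S, a ≠ k := fun a ha h => hk (h ▸ ha)
  have hH := hx.holds hi hj hij
  have hgt : ∀ a ∈ S.filter (fun a => k < a), k < a := fun a ha => (Finset.mem_filter.1 ha).2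
  have hlt : ∀ a ∈ S.filter (fun a => a < k), a < k := fun a ha => (Finset.mem_filter.1 ha).2
  have hcard : (S.filter fun a => k < a).card + (S.filter fun a => a < k).card = S.card := by
    rw [← Finset.card_filter_add_card_filter_not (s := S) (fun a => k < a)]
    congr 2
    refine Finset.filter_congr fun a ha => ?_
    rw [not_lt]
    exact ⟨le_of_lt, fun h => lt_of_le_of_ne h (hne a ha)⟩
  cases κ with
  | diffZero =>
    have hij' : i < j := hij
    have hH' : x i = x j := hH
    have hinj : ∀ b, (b = i ∨ b = j) → Set.InjOn x ((S \ {b} : Finset ι) : Set ι) := by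
      intro b hb c hc d hd h
      simp only [Finset.mem_coe, Finset.mem_sdiff, Finset.mem_singleton] at hc hd
      rcases hx.eq_of_eq hc.1 hd.1 h with h | ⟨-, h⟩
      · exact h
      · grind
    have hsub : ∀ (b : ι) (p : ι → Prop) [DecidablePred p],
        (((S \ {b}).filter p : Finset ι) : Set ι) ⊆ ((S \ {b} : Finset ι) : Set ι) :=
      fun b p _ => Finset.coe_subset.2 (Finset.filter_subset ..)
    -- The cells of `-i` and `-j` coincide, and those of `i` and `j` block the same slot if both
    -- labels are above `k` or both are below.  As `i < j`, dropping `i` above `k` and `j` below `k`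
    -- never drops one whose partner is on the other side.
    have h := ncard_isFreeSlot_add (k := k) (x := x) (S := S)
      (P := (S \ {i}).filter fun a => k < a) (N := S \ {j}) (L := (S \ {j}).filter fun a => a < k)
      (by grind) (by grind) (by grind) (by grind) (by grind)
      ((hinj i (.inl rfl)).mono (hsub ..)) (hinj j (.inr rfl)) ((hinj j (.inr rfl)).mono (hsub ..))
      (fun a ha b hb h => by
        have := (hx.eq_of_add_eq_zero (a := a) (b := b) (by grind) (by grind) h).1
        contradiction)
      (fun a ha b hb h => by
        have := (hx.eq_of_eq_add_one (a := a) (b := b) (by grind) (by grind) (by grind) h).1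
        contradiction)
      (fun a ha b hb h => by
        have := (hx.eq_of_add_eq_one (a := a) (b := b) (by grind) (by grind) h).1
        contradiction)
      (by grind) (by grind) (by grind)
    have h₁ := card_filter_sdiff_add (Finset.singleton_subset_iff.2 hi) (fun a => k < a)
    have h₂ := card_filter_sdiff_add (Finset.singleton_subset_iff.2 hj) (fun a => a < k)
    have h₃ := Finset.card_sdiff_add_card_eq_card (Finset.singleton_subset_iff.2 hj)
    have hki := hne i hi
    have hkj := hne j hj
    rw [Finset.filter_singleton] at h₁ h₂
    simp only [slotExcess]
    rw [Finset.card_singleton] at h₃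
    split_ifs at h₁ h₂ ⊢ <;> simp only [Finset.card_singleton, Finset.card_empty] at h₁ h₂ <;>
      first | omega | (exfalso; grind)
  | diffOne =>
    have hij' : i < j := hij
    have hH' : x i = x j + 1 := hH
    have hinj : Set.InjOn x S := by
      intro c hc d hd h
      rcases hx.eq_of_eq hc hd h with h | ⟨h, -⟩
      · exact h
      · contradiction
    -- If `i < k < j`, the slot after the cell of `j` is also the slot before the cell of `i`.
    obtain ⟨E, hE⟩ : ∃ E : Finset ι, E = if i < k ∧ k < j then {i} else ∅ := ⟨_, rfl⟩
    have hES : E ⊆ S := by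
      rw [hE]; split_ifs <;> simp [hi]
    have h := ncard_isFreeSlot_add (k := k) (x := x) (S := S)
      (P := S.filter fun a => k < a) (N := S) (L := (S \ E).filter fun a => a < k)
      (by grind) (by grind) (by grind) (by grind) (by grind)
      (hinj.mono (Finset.coe_subset.2 (by grind))) hinj (hinj.mono (Finset.coe_subset.2 (by grind)))
      (fun a ha b hb h => by
        have := (hx.eq_of_add_eq_zero (a := a) (b := b) (by grind) (by grind) h).1
        contradiction)
      (fun a ha b hb h => by
        have := (hx.eq_of_eq_add_one (a := a) (b := b) (by grind) (by grind) (by grind) h).2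
        grind)
      (fun a ha b hb h => by
        have := (hx.eq_of_add_eq_one (a := a) (b := b) (by grind) (by grind) h).1
        contradiction)
      (by grind) (by grind) (by grind)
    have h₂ := card_filter_sdiff_add hES (fun a => a < k)
    simp only [slotExcess]
    rw [hE] at h h₂
    split_ifs at h h₂ ⊢ with hc
    · rw [Finset.filter_singleton, if_pos hc.1, Finset.card_singleton] at h₂
      omega
    · rw [Finset.filter_empty, Finset.card_empty] at h₂
      omega
  | sumZero =>
    have hH' : x i + x j = 0 := hH
    have hH'' : x j + x i = 0 := (add_comm _ _).trans hH'
    have hinj : Set.InjOn x S := by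
      intro c hc d hd h
      rcases hx.eq_of_eq hc hd h with h | ⟨h, -⟩
      · exact h
      · contradiction
    have hES : ({i, j} : Finset ι) ⊆ S := by grind
    -- The cells of `i` and `j` are those of `-j` and `-i`, which always count as above `k`.
    have h := ncard_isFreeSlot_add (k := k) (x := x) (S := S)
      (P := (S \ {i, j}).filter fun a => k < a) (N := S) (L := S.filter fun a => a < k)
      (by grind) (by grind) (by grind) (by grind) (by grind)
      (hinj.mono (Finset.coe_subset.2 (by grind))) hinj (hinj.mono (Finset.coe_subset.2 (by grind)))
      (fun a ha b hb h => by
        have := (hx.eq_of_add_eq_zero (a := a) (b := b) (by grind) (by grind) h).2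
        grind)
      (fun a ha b hb h => by
        have := (hx.eq_of_eq_add_one (a := a) (b := b) (by grind) (by grind) (by grind) h).1
        contradiction)
      (fun a ha b hb h => by
        have := (hx.eq_of_add_eq_one (a := a) (b := b) (by grind) (by grind) h).1
        contradiction)
      (by grind) (by grind) (by grind)
    have h₂ := card_filter_sdiff_add hES (fun a => k < a)
    simp only [slotExcess]
    omega
  | sumOne =>
    have hH' : x i + x j = 1 := hH
    have hH'' : x j + x i = 1 := (add_comm _ _).trans hH'
    have hinj : Set.InjOn x S := by
      intro c hc d hd h
      rcases hx.eq_of_eq hc hd h with h | ⟨h, -⟩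
      · exact h
      · contradiction
    have hES : ({i, j} : Finset ι) ⊆ S := by grind
    -- The slots before the cells of `i` and `j` are the slots after those of `-j` and `-i`.
    have h := ncard_isFreeSlot_add (k := k) (x := x) (S := S)
      (P := S.filter fun a => k < a) (N := S) (L := (S \ {i, j}).filter fun a => a < k)
      (by grind) (by grind) (by grind) (by grind) (by grind)
      (hinj.mono (Finset.coe_subset.2 (by grind))) hinj (hinj.mono (Finset.coe_subset.2 (by grind)))
      (fun a ha b hb h => by
        have := (hx.eq_of_add_eq_zero (a := a) (b := b) (by grind) (by grind) h).1
        contradiction)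
      (fun a ha b hb h => by
        have := (hx.eq_of_eq_add_one (a := a) (b := b) (by grind) (by grind) (by grind) h).1
        contradiction)
      (fun a ha b hb h => by
        have := (hx.eq_of_add_eq_one (a := a) (b := b) (by grind) (by grind) h).2
        grind)
      (by grind) (by grind) (by grind)
    have h₂ := card_filter_sdiff_add hES (fun a => a < k)
    simp only [slotExcess]
    omega

end FreeSlots

/-! ### Counting the configurations -/

section Counting

variable {ι : Type*} [LinearOrder ι] {κ : ShiKind} {i j : ι}

/-- Inserting the remaining labels one by one: `t = q - 2 |S|` does not change when `S` gains a
label and `q` grows by `2`. -/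
theorem ncard_isConfigOn_union [Finite ι] (hij : κ.Admissible i j) {t B : ℕ}
    (hB : {x : ι → ZMod (t + 2 * ({i, j} : Finset ι).card) | IsConfigOn κ i j {i, j} x}.ncard = B)
    (R : Finset ι) (hR : Disjoint ({i, j} : Finset ι) R) :
    {x : ι → ZMod (t + 2 * ({i, j} ∪ R : Finset ι).card) |
      IsConfigOn κ i j ({i, j} ∪ R) x}.ncard = B * ∏ k ∈ R, (t + slotExcess κ i j k) := by
  classical
  induction R using Finset.induction_on with
  | empty =>
    rw [Finset.prod_empty, mul_one, ← hB, Finset.union_empty]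
  | insert k R hk ih =>
    rw [Finset.disjoint_insert_right] at hR
    specialize ih hR.2
    rw [Finset.union_insert, Finset.prod_insert hk]
    obtain ⟨S, hS⟩ : ∃ S, S = {i, j} ∪ R := ⟨_, rfl⟩
    have hi : i ∈ S := by simp [hS]
    have hj : j ∈ S := by simp [hS]
    have hkS : k ∉ S := by rw [hS, Finset.mem_union, not_or]; exact ⟨hR.1, hk⟩
    have hpos : 0 < S.card := Finset.card_pos.2 ⟨i, hi⟩
    rw [← hS] at ih ⊢
    have hq : t + 2 * (insert k S).card = t + 2 * S.card + 2 := by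
      rw [Finset.card_insert_of_notMem hkS]; ring
    have : NeZero (t + 2 * S.card) := ⟨by omega⟩
    rw [hq, show {x : ι → ZMod (t + 2 * S.card + 2) |
        IsConfigOn κ i j (insert k S) x}.ncard = _ from
        ncard_isConfig_insert (c := t + slotExcess κ i j k) (by omega) hkS ?_ ?_]
    · rw [show {x : ι → ZMod (t + 2 * S.card) | IsConfig _ S x}.ncard = _ from ih]
      ring
    · rintro κ' a b ⟨-, rfl, rfl⟩
      exact ⟨fun h => hkS (h ▸ hi), fun h => hkS (h ▸ hj)⟩
    · intro x hx
      have := IsConfigOn.ncard_isFreeSlot hx hi hj hij hkS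
      omega

variable {q : ℕ}

theorem isConfigOn_pair_iff (hij : i < j) {x : ι → ZMod q} :
    IsConfigOn κ i j {i, j} x ↔ (∀ a, a ≠ i → a ≠ j → x a = 0) ∧
      (x i = x j ↔ .diffZero = κ) ∧ (x i = x j + 1 ↔ .diffOne = κ) ∧
      (x i + x j = 0 ↔ .sumZero = κ) ∧ (x i + x j = 1 ↔ .sumOne = κ) ∧
      x i + x i ≠ 0 ∧ x i + x i ≠ 1 ∧ x j + x j ≠ 0 ∧ x j + x j ≠ 1 := by
  have hi : i ∈ ({i, j} : Finset ι) := by simp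
  have hj : j ∈ ({i, j} : Finset ι) := by simp
  constructor
  · rintro ⟨h₀, h⟩
    refine ⟨fun a hai haj => h₀ a (by simp [hai, haj]), ?_, ?_, ?_, ?_, ?_, ?_, ?_, ?_⟩
    · simpa [ShiKind.Holds] using h .diffZero i j hi hj hij
    · simpa [ShiKind.Holds] using h .diffOne i j hi hj hij
    · simpa [ShiKind.Holds] using h .sumZero i j hi hj hij.le
    · simpa [ShiKind.Holds] using h .sumOne i j hi hj hij.le
    · exact fun h' => hij.ne ((h .sumZero i i hi hi (le_refl i)).1 h').2.2
    · exact fun h' => hij.ne ((h .sumOne i i hi hi (le_refl i)).1 h').2.2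
    · exact fun h' => hij.ne' ((h .sumZero j j hj hj (le_refl j)).1 h').2.1
    · exact fun h' => hij.ne' ((h .sumOne j j hj hj (le_refl j)).1 h').2.1
  · rintro ⟨h₀, h₁, h₂, h₃, h₄, h₅, h₆, h₇, h₈⟩
    refine ⟨fun a ha => ?_, fun κ' a b ha hb hab => ?_⟩
    · simp only [Finset.mem_insert, Finset.mem_singleton, not_or] at ha
      exact h₀ a ha.1 ha.2
    simp only [Finset.mem_insert, Finset.mem_singleton] at ha hb
    rcases ha with rfl | rfl <;> rcases hb with rfl | rfl <;> cases κ' <;>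
      simp_all [ShiKind.Admissible, ShiKind.Holds, hij.ne, hij.ne', hij.not_gt, hij.not_ge]

theorem isConfigOn_singleton_iff {x : ι → ZMod q} :
    IsConfigOn κ i i {i} x ↔ (∀ a, a ≠ i → x a = 0) ∧
      (x i + x i = 0 ↔ .sumZero = κ) ∧ (x i + x i = 1 ↔ .sumOne = κ) := by
  have hi : i ∈ ({i} : Finset ι) := by simp
  constructor
  · rintro ⟨h₀, h⟩
    refine ⟨fun a hai => h₀ a (by simp [hai]), ?_, ?_⟩
    · simpa [ShiKind.Holds] using h .sumZero i i hi hi (le_refl i)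
    · simpa [ShiKind.Holds] using h .sumOne i i hi hi (le_refl i)
  · rintro ⟨h₀, h₁, h₂⟩
    refine ⟨fun a ha => h₀ a (by simpa using ha), fun κ' a b ha hb hab => ?_⟩
    rw [Finset.mem_singleton] at ha hb
    subst ha hb
    cases κ' <;> simp_all [ShiKind.Admissible, ShiKind.Holds]

variable [NeZero q]

theorem ncard_val_mem {A : Finset ℕ} (hA : ∀ n ∈ A, n < q) :
    {v : ZMod q | v.val ∈ A}.ncard = A.card := by
  rw [← Set.ncard_coe_finset A, ← Set.ncard_image_of_injective _ (ZMod.val_injective q)]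
  congr 1
  ext n
  simp only [Set.mem_image, Set.mem_ofPred_eq, Finset.mem_coe]
  refine ⟨?_, fun hn => ⟨n, ?_, ZMod.val_cast_of_lt (hA n hn)⟩⟩
  · rintro ⟨v, hv, rfl⟩
    exact hv
  · rwa [ZMod.val_cast_of_lt (hA n hn)]

theorem ncard_val_notMem_add {A : Finset ℕ} (hA : ∀ n ∈ A, n < q) :
    {v : ZMod q | v.val ∉ A}.ncard + A.card = q := by
  rw [← ncard_val_mem hA, add_comm]
  exact (Set.ncard_add_ncard_compl {v : ZMod q | v.val ∈ A}).trans (Nat.card_zmod q)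

theorem ncard_isConfigOn_pair_add (hij : i < j) (f : ZMod q → ZMod q) {A : Finset ℕ}
    (hA : ∀ n ∈ A, n < q)
    (h : ∀ u v : ZMod q, ((u = v ↔ .diffZero = κ) ∧ (u = v + 1 ↔ .diffOne = κ) ∧
      (u + v = 0 ↔ .sumZero = κ) ∧ (u + v = 1 ↔ .sumOne = κ) ∧
      u + u ≠ 0 ∧ u + u ≠ 1 ∧ v + v ≠ 0 ∧ v + v ≠ 1) ↔ u = f v ∧ v.val ∉ A) :
    {x : ι → ZMod q | IsConfigOn κ i j {i, j} x}.ncard + A.card = q := by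
  have hset : {x : ι → ZMod q | IsConfigOn κ i j {i, j} x} =
      (fun v => Function.update (Function.update (0 : ι → ZMod q) j v) i (f v)) ''
        {v : ZMod q | v.val ∉ A} := by
    ext x
    rw [Set.mem_ofPred_eq, isConfigOn_pair_iff hij, h]
    constructor
    · rintro ⟨h₀, h₁, h₂⟩
      refine ⟨x j, h₂, funext fun a => ?_⟩
      beta_reduce
      by_cases hai : a = i
      · rw [hai, Function.update_self, h₁]
      · rw [Function.update_of_ne hai]
        by_cases haj : a = j
        · rw [haj, Function.update_self]
        · rw [Function.update_of_ne haj, h₀ a hai haj, Pi.zero_apply]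
    · rintro ⟨v, hv, rfl⟩
      refine ⟨fun a hai haj => ?_, ?_, ?_⟩ <;> beta_reduce
      · rw [Function.update_of_ne hai, Function.update_of_ne haj, Pi.zero_apply]
      · rw [Function.update_self, Function.update_of_ne hij.ne', Function.update_self]
      · rwa [Function.update_of_ne hij.ne', Function.update_self]
  rw [hset, Set.ncard_image_of_injective, ncard_val_notMem_add hA]
  intro v w hvw
  have := congrFun hvw j
  simpa [Function.update_of_ne hij.ne'] using this

theorem ncard_isConfigOn_singleton {A : Finset ℕ} (hA : ∀ n ∈ A, n < q)
    (h : ∀ v : ZMod q, ((v + v = 0 ↔ .sumZero = κ) ∧ (v + v = 1 ↔ .sumOne = κ)) ↔ v.val ∈ A) :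
    {x : ι → ZMod q | IsConfigOn κ i i {i, i} x}.ncard = A.card := by
  have hset : {x : ι → ZMod q | IsConfigOn κ i i {i, i} x} =
      (fun v => Function.update (0 : ι → ZMod q) i v) '' {v : ZMod q | v.val ∈ A} := by
    ext x
    rw [Set.mem_ofPred_eq, Finset.pair_eq_singleton, isConfigOn_singleton_iff, h]
    constructor
    · rintro ⟨h₀, h₁⟩
      refine ⟨x i, h₁, funext fun a => ?_⟩
      beta_reduce
      by_cases hai : a = i
      · rw [hai, Function.update_self]
      · rw [Function.update_of_ne hai, h₀ a hai, Pi.zero_apply]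
    · rintro ⟨v, hv, rfl⟩
      refine ⟨fun a hai => ?_, ?_⟩ <;> beta_reduce
      · rw [Function.update_of_ne hai, Pi.zero_apply]
      · rwa [Function.update_self]
  rw [hset, Set.ncard_image_of_injective, ncard_val_mem hA]
  exact Function.update_injective (0 : ι → ZMod q) i

/-- On the hyperplane of the family `κ` the value `v` of `x_j` determines that of `x_i`.  The other
hyperplanes exclude the solutions `v` of `2 v = c` for `c = 0, 1`; `c = 0, 1, -1, -2`;
`c = 0, 1, -1`; `c = 0, 1, 2` in the four families, and `2 v = c` has one solution if `q` is odd,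
two if `q` and `c` are even, and none if `q` is even and `c` is odd. -/
theorem ncard_isConfigOn_pair (hq : 5 ≤ q) (hij : i < j) :
    {x : ι → ZMod q | IsConfigOn κ i j {i, j} x}.ncard +
      (match κ with
        | .diffZero => 2
        | .diffOne => 4
        | .sumZero => if Odd q then 3 else 2
        | .sumOne => if Odd q then 3 else 4) = q := by
  cases κ with
  | diffZero =>
    have h := ncard_isConfigOn_pair_add (κ := .diffZero) (q := q) hij (fun v => v)
      (A := {0, (q + 1) / 2}) (by simp; omega) fun u v => by
        have := u.val_lt
        have := v.val_lt
        simp only [ZMod.eq_iff_val_eq u v, ZMod.eq_add_one_iff_val u v,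
          ZMod.add_eq_zero_iff_val, ZMod.add_eq_one_iff_val (show 2 ≤ q by omega),
          Finset.mem_insert, Finset.mem_singleton, reduceCtorEq, iff_true, iff_false, Ne]
        omega
    rwa [Finset.card_pair (by omega)] at h
  | diffOne =>
    have h := ncard_isConfigOn_pair_add (κ := .diffOne) (q := q) hij (fun v => v + 1)
      (A := {0, (q + 1) / 2, q - 1, (q - 1) / 2}) (by simp; omega) fun u v => by
        have := u.val_lt
        have := v.val_lt
        simp only [ZMod.eq_iff_val_eq u v, ZMod.eq_add_one_iff_val u v,
          ZMod.add_eq_zero_iff_val, ZMod.add_eq_one_iff_val (show 2 ≤ q by omega),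
          Finset.mem_insert, Finset.mem_singleton, reduceCtorEq, iff_true, iff_false, Ne]
        omega
    rwa [Finset.card_insert_of_notMem, Finset.card_insert_of_notMem, Finset.card_pair] at h
    all_goals simp
    all_goals omega
  | sumZero =>
    have h := ncard_isConfigOn_pair_add (κ := .sumZero) (q := q) hij (fun v => -v)
      (A := {0, q / 2, (q + 1) / 2}) (by simp; omega) fun u v => by
        have := u.val_lt
        have := v.val_lt
        simp only [eq_neg_iff_add_eq_zero, ZMod.eq_iff_val_eq u v, ZMod.eq_add_one_iff_val u v,
          ZMod.add_eq_zero_iff_val, ZMod.add_eq_one_iff_val (show 2 ≤ q by omega),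
          Finset.mem_insert, Finset.mem_singleton, reduceCtorEq, iff_true, iff_false, Ne]
        omega
    rw [Finset.card_insert_of_notMem (by simp; omega)] at h
    simp only
    split_ifs with hodd
    · rw [Nat.odd_iff] at hodd
      rwa [Finset.card_pair (by omega)] at h
    · rw [Nat.odd_iff] at hodd
      rwa [show (q + 1) / 2 = q / 2 by omega, Finset.pair_eq_singleton] at h
  | sumOne =>
    have h := ncard_isConfigOn_pair_add (κ := .sumOne) (q := q) hij (fun v => 1 - v)
      (A := {0, 1, (q + 1) / 2, (q + 2) / 2}) (by simp; omega) fun u v => by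
        have := u.val_lt
        have := v.val_lt
        simp only [eq_sub_iff_add_eq, ZMod.eq_iff_val_eq u v, ZMod.eq_add_one_iff_val u v,
          ZMod.add_eq_zero_iff_val, ZMod.add_eq_one_iff_val (show 2 ≤ q by omega),
          Finset.mem_insert, Finset.mem_singleton, reduceCtorEq, iff_true, iff_false, Ne]
        omega
    rw [Finset.card_insert_of_notMem (by simp; omega),
      Finset.card_insert_of_notMem (by simp; omega)] at h
    simp only
    split_ifs with hodd
    · rw [Nat.odd_iff] at hodd
      rwa [show (q + 2) / 2 = (q + 1) / 2 by omega, Finset.pair_eq_singleton] at h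
    · rw [Nat.odd_iff] at hodd
      rwa [Finset.card_pair (by omega)] at h

theorem ncard_isConfigOn_sumZero_self (hq : 2 ≤ q) :
    {x : ι → ZMod q | IsConfigOn .sumZero i i {i, i} x}.ncard = if Odd q then 1 else 2 := by
  split_ifs with hodd
  · rw [Nat.odd_iff] at hodd
    refine ncard_isConfigOn_singleton (A := {0}) (by simp; omega) fun v => ?_
    have := v.val_lt
    simp only [ZMod.add_eq_zero_iff_val, ZMod.add_eq_one_iff_val hq, Finset.mem_singleton,
      reduceCtorEq, iff_true, iff_false]
    omega
  · rw [Nat.odd_iff] at hodd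
    rw [ncard_isConfigOn_singleton (A := {0, q / 2}) (by simp; omega), Finset.card_pair (by omega)]
    intro v
    have := v.val_lt
    simp only [ZMod.add_eq_zero_iff_val, ZMod.add_eq_one_iff_val hq, Finset.mem_insert,
      Finset.mem_singleton, reduceCtorEq, iff_true, iff_false]
    omega

theorem ncard_isConfigOn_sumOne_self (hq : 2 ≤ q) :
    {x : ι → ZMod q | IsConfigOn .sumOne i i {i, i} x}.ncard = if Odd q then 1 else 0 := by
  split_ifs with hodd
  · rw [Nat.odd_iff] at hodd
    refine ncard_isConfigOn_singleton (A := {(q + 1) / 2}) (by simp; omega) fun v => ?_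
    have := v.val_lt
    simp only [ZMod.add_eq_zero_iff_val, ZMod.add_eq_one_iff_val hq, Finset.mem_singleton,
      reduceCtorEq, iff_true, iff_false]
    omega
  · rw [Nat.odd_iff] at hodd
    refine ncard_isConfigOn_singleton (A := ∅) (by simp) fun v => ?_
    have := v.val_lt
    simp only [ZMod.add_eq_zero_iff_val, ZMod.add_eq_one_iff_val hq, Finset.notMem_empty,
      reduceCtorEq, iff_true, iff_false]
    omega

end Counting

/-! ### The Shi arrangement of type C -/

section Arrangement

variable {m : ℕ}

/-- The hyperplane of a family with labels `a`, `b`. -/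
def ShiKind.hyperplane : ShiKind → Fin m → Fin m → IntHyperplane m
  | .diffZero, a, b => .diff a b 0
  | .diffOne, a, b => .diff a b 1
  | .sumZero, a, b => .sum a b 0
  | .sumOne, a, b => .sum a b 1

theorem IntHyperplane.double_eq_sum (i : Fin m) (b : ℤ) :
    IntHyperplane.double i b = IntHyperplane.sum i i b := by
  simp [IntHyperplane.double, IntHyperplane.sum, ← Pi.single_add]

theorem mem_shiC_iff {K : IntHyperplane m} :
    K ∈ shiC m ↔ ∃ (κ : ShiKind) (a b : Fin m), κ.Admissible a b ∧ K = κ.hyperplane a b := by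
  constructor
  · rintro (⟨i, h | h⟩ | ⟨i, j, hij, h | h | h | h⟩)
    · exact ⟨.sumZero, i, i, le_refl i, h.trans (IntHyperplane.double_eq_sum i 0)⟩
    · exact ⟨.sumOne, i, i, le_refl i, h.trans (IntHyperplane.double_eq_sum i 1)⟩
    · exact ⟨.diffZero, i, j, hij, h⟩
    · exact ⟨.diffOne, i, j, hij, h⟩
    · exact ⟨.sumZero, i, j, hij.le, h⟩
    · exact ⟨.sumOne, i, j, hij.le, h⟩
  · rintro ⟨κ, a, b, hab, rfl⟩
    cases κ with
    | diffZero => exact .inr ⟨a, b, hab, .inl rfl⟩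
    | diffOne => exact .inr ⟨a, b, hab, .inr (.inl rfl)⟩
    | sumZero =>
      rcases (show a ≤ b from hab).eq_or_lt with rfl | h
      · exact .inl ⟨a, .inl (IntHyperplane.double_eq_sum a 0).symm⟩
      · exact .inr ⟨a, b, h, .inr (.inr (.inl rfl))⟩
    | sumOne =>
      rcases (show a ≤ b from hab).eq_or_lt with rfl | h
      · exact .inl ⟨a, .inr (IntHyperplane.double_eq_sum a 1).symm⟩
      · exact .inr ⟨a, b, h, .inr (.inr (.inr rfl))⟩

theorem mem_reduction_hyperplane {q : ℕ} {κ : ShiKind} {a b : Fin m} {x : Fin m → ZMod q} :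
    x ∈ (κ.hyperplane a b).reduction q ↔ κ.Holds (x a) (x b) := by
  have h : ∀ c : Fin m, ∑ k, ((Pi.single c 1 : Fin m → ℤ) k : ZMod q) * x k = x c := by
    intro c
    simp [Pi.single_apply]
  cases κ <;>
    simp [IntHyperplane.reduction, ShiKind.hyperplane, IntHyperplane.diff, IntHyperplane.sum,
      ShiKind.Holds, sub_mul, add_mul, Finset.sum_sub_distrib, Finset.sum_add_distrib, h,
      sub_eq_iff_eq_add']

theorem hyperplane_injective {κ κ' : ShiKind} {a b a' b' : Fin m} (h : κ.Admissible a b)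
    (h' : κ'.Admissible a' b') (he : κ.hyperplane a b = κ'.hyperplane a' b') :
    κ = κ' ∧ a = a' ∧ b = b' := by
  have hconst := congrArg IntHyperplane.const he
  have hcoeff := fun k => congrFun (congrArg IntHyperplane.coeff he) k
  have h₁ := hcoeff a
  have h₂ := hcoeff b
  have h₃ := hcoeff a'
  have h₄ := hcoeff b'
  cases κ <;> cases κ' <;>
    simp only [ShiKind.hyperplane, IntHyperplane.diff, IntHyperplane.sum, ShiKind.Admissible,
      Pi.sub_apply, Pi.add_apply, Pi.single_apply, reduceCtorEq, false_and, true_and]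
      at h h' hconst h₁ h₂ h₃ h₄ ⊢ <;> grind

theorem restrictionComplement_shiC {q : ℕ} {κ : ShiKind} {i j : Fin m} (hij : κ.Admissible i j) :
    restrictionComplement (shiC m) (κ.hyperplane i j) q =
      {x : Fin m → ZMod q | IsConfigOn κ i j Finset.univ x} := by
  ext x
  simp only [restrictionComplement, restrictionReduction, Set.sUnion_image, Set.mem_sdiff,
    Set.mem_iUnion, Set.mem_inter_iff, not_exists, not_and, Set.mem_singleton_iff,
    Set.mem_ofPred_eq, and_imp]
  constructor
  · rintro ⟨hH, hK⟩
    refine ⟨fun a ha => absurd (Finset.mem_univ a) ha, fun κ' a b _ _ hab => ⟨fun h => ?_, ?_⟩⟩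
    · by_contra hne
      refine hK (κ'.hyperplane a b) (mem_shiC_iff.2 ⟨κ', a, b, hab, rfl⟩) (fun he => ?_) hH
        (mem_reduction_hyperplane.2 h)
      exact hne (hyperplane_injective hab hij he)
    · rintro ⟨rfl, rfl, rfl⟩
      exact mem_reduction_hyperplane.1 hH
  · intro hx
    refine ⟨mem_reduction_hyperplane.2
      (hx.holds (Finset.mem_univ i) (Finset.mem_univ j) hij), fun K hK hne _ h => ?_⟩
    obtain ⟨κ', a, b, hab, rfl⟩ := mem_shiC_iff.1 hK
    obtain ⟨rfl, rfl, rfl⟩ := (hx.2 κ' a b (Finset.mem_univ a) (Finset.mem_univ b) hab).1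
      (mem_reduction_hyperplane.1 h)
    exact hne rfl

theorem prod_sdiff_pair {i j : Fin m} (hij : i ≤ j) {g : Fin m → ℕ} {α β γ : ℕ}
    (hα : ∀ k, k < i → g k = α) (hβ : ∀ k, i < k → k < j → g k = β) (hγ : ∀ k, j < k → g k = γ) :
    ∏ k ∈ Finset.univ \ {i, j}, g k =
      α ^ (i : ℕ) * β ^ ((j : ℕ) - i - 1) * γ ^ (m - 1 - (j : ℕ)) := by
  have hset : Finset.univ \ {i, j} = (Finset.Iio i ∪ Finset.Ioo i j) ∪ Finset.Ioi j := by
    ext k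
    simp only [Finset.mem_sdiff, Finset.mem_univ, Finset.mem_insert, Finset.mem_singleton,
      Finset.mem_union, Finset.mem_Iio, Finset.mem_Ioo, Finset.mem_Ioi, true_and]
    omega
  rw [hset, Finset.prod_union, Finset.prod_union,
    Finset.prod_congr rfl fun k hk => hα k (Finset.mem_Iio.1 hk),
    Finset.prod_congr rfl fun k hk => hβ k (Finset.mem_Ioo.1 hk).1 (Finset.mem_Ioo.1 hk).2,
    Finset.prod_congr rfl fun k hk => hγ k (Finset.mem_Ioi.1 hk)]
  · simp
  · rw [Finset.disjoint_left]
    intro k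
    simp only [Finset.mem_Iio, Finset.mem_Ioo]
    omega
  · rw [Finset.disjoint_left]
    intro k
    simp only [Finset.mem_union, Finset.mem_Iio, Finset.mem_Ioo, Finset.mem_Ioi]
    omega

/-- The number of points on a Shi hyperplane and on no other one, from the count `B` for the labels
of that hyperplane alone and the slot numbers of the labels before, between and after them. -/
theorem ncard_restrictionComplement_shiC {κ : ShiKind} {i j : Fin m} (hij : κ.Admissible i j)
    {t q B α β γ : ℕ} (hq : q = t + 2 * m)
    (hB : {x : Fin m → ZMod (t + 2 * ({i, j} : Finset (Fin m)).card) |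
      IsConfigOn κ i j {i, j} x}.ncard = B)
    (hα : ∀ k, k < i → slotExcess κ i j k = α)
    (hβ : ∀ k, i < k → k < j → slotExcess κ i j k = β)
    (hγ : ∀ k, j < k → slotExcess κ i j k = γ) :
    (restrictionComplement (shiC m) (κ.hyperplane i j) q).ncard =
      B * ((t + α) ^ (i : ℕ) * (t + β) ^ ((j : ℕ) - i - 1) * (t + γ) ^ (m - 1 - (j : ℕ))) := by
  have hle : i ≤ j := by
    cases κ with
    | diffZero => exact le_of_lt hij
    | diffOne => exact le_of_lt hij
    | sumZero => exact hij
    | sumOne => exact hij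
  have h := ncard_isConfigOn_union hij hB (Finset.univ \ {i, j}) Finset.disjoint_sdiff
  rw [Finset.union_sdiff_of_subset (Finset.subset_univ _), Finset.card_univ, Fintype.card_fin,
    ← hq, prod_sdiff_pair hle (fun k hk => by rw [hα k hk]) (fun k hk hk' => by rw [hβ k hk hk'])
      (fun k hk => by rw [hγ k hk])] at h
  rw [restrictionComplement_shiC hij, h]

end Arrangement

/-! ### Quasi-polynomials -/

section QuasiPolynomial

open Polynomial

theorem isQuasiPolynomial_one {f : ℕ → ℤ} (A : ℤ[X]) (h : ∀ q : ℕ, f q = A.eval (q : ℤ)) :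
    IsQuasiPolynomial 1 f :=
  ⟨one_pos, fun _ => A, h⟩

theorem isQuasiPolynomial_two {f : ℕ → ℤ} (A B : ℤ[X])
    (h : ∀ q : ℕ, f q = if Odd q then A.eval (q : ℤ) else B.eval (q : ℤ)) :
    IsQuasiPolynomial 2 f := by
  refine ⟨two_pos, fun r => if r = 1 then A else B, fun q => ?_⟩
  simp only [h, Nat.odd_iff]
  split_ifs <;> rfl

end QuasiPolynomial

/-! ### The six families of restrictions -/

section Restrictions

variable {m t q : ℕ} {i j : Fin m}

theorem slotExcess_sumZero_self {ι : Type*} [LinearOrder ι] (i k : ι) :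
    slotExcess .sumZero i i k = if k < i then 1 else 0 := by
  simp only [slotExcess, Finset.pair_eq_singleton, Finset.filter_singleton]
  split_ifs <;> rfl

theorem slotExcess_sumOne_self {ι : Type*} [LinearOrder ι] (i k : ι) :
    slotExcess .sumOne i i k = if i < k then 1 else 0 := by
  simp only [slotExcess, Finset.pair_eq_singleton, Finset.filter_singleton]
  split_ifs <;> rfl

theorem slotExcess_sumZero_of_ne {ι : Type*} [LinearOrder ι] {i j : ι} (h : i ≠ j) (k : ι) :
    slotExcess .sumZero i j k = (if k < i then 1 else 0) + if k < j then 1 else 0 := by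
  simp only [slotExcess, Finset.card_filter, Finset.sum_pair h]

theorem slotExcess_sumOne_of_ne {ι : Type*} [LinearOrder ι] {i j : ι} (h : i ≠ j) (k : ι) :
    slotExcess .sumOne i j k = (if i < k then 1 else 0) + if j < k then 1 else 0 := by
  simp only [slotExcess, Finset.card_filter, Finset.sum_pair h]

theorem ncard_restriction_double_zero (hq : q = t + 2 * m) :
    (restrictionComplement (shiC m) (.double i 0) q).ncard =
      (if Odd q then 1 else 2) * ((t + 1) ^ (i : ℕ) * t ^ (m - 1 - (i : ℕ))) := by
  have hcard : ({i, i} : Finset (Fin m)).card = 1 := by simp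
  have : NeZero (t + 2 * ({i, i} : Finset (Fin m)).card) := ⟨by omega⟩
  have hodd : Odd (t + 2 * ({i, i} : Finset (Fin m)).card) ↔ Odd q := by
    rw [Nat.odd_iff, Nat.odd_iff]; omega
  rw [IntHyperplane.double_eq_sum]
  refine (ncard_restrictionComplement_shiC (κ := .sumZero) (α := 1) (β := 0) (γ := 0) (le_refl i) hq
    (ncard_isConfigOn_sumZero_self (by omega)) ?_ ?_ ?_).trans ?_
  · intro k hk
    rw [slotExcess_sumZero_self, if_pos hk]
  · exact fun k hk hk' => absurd hk' hk.not_gt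
  · intro k hk
    rw [slotExcess_sumZero_self, if_neg hk.not_gt]
  · simp only [hodd]
    simp

theorem ncard_restriction_double_one (hq : q = t + 2 * m) :
    (restrictionComplement (shiC m) (.double i 1) q).ncard =
      (if Odd q then 1 else 0) * (t ^ (i : ℕ) * (t + 1) ^ (m - 1 - (i : ℕ))) := by
  have hcard : ({i, i} : Finset (Fin m)).card = 1 := by simp
  have : NeZero (t + 2 * ({i, i} : Finset (Fin m)).card) := ⟨by omega⟩
  have hodd : Odd (t + 2 * ({i, i} : Finset (Fin m)).card) ↔ Odd q := by
    rw [Nat.odd_iff, Nat.odd_iff]; omega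
  rw [IntHyperplane.double_eq_sum]
  refine (ncard_restrictionComplement_shiC (κ := .sumOne) (α := 0) (β := 0) (γ := 1) (le_refl i) hq
    (ncard_isConfigOn_sumOne_self (by omega)) ?_ ?_ ?_).trans ?_
  · intro k hk
    rw [slotExcess_sumOne_self, if_neg hk.not_gt]
  · exact fun k hk hk' => absurd hk' hk.not_gt
  · intro k hk
    rw [slotExcess_sumOne_self, if_pos hk]
  · simp only [hodd]
    simp

theorem ncard_restriction_diff_zero (hij : i < j) (ht : 1 ≤ t) (hq : q = t + 2 * m) :
    (restrictionComplement (shiC m) (.diff i j 0) q).ncard =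
      (t + 2) * ((t + 2) ^ (i : ℕ) * (t + 1) ^ ((j : ℕ) - i - 1) *
        (t + 2) ^ (m - 1 - (j : ℕ))) := by
  have hcard : ({i, j} : Finset (Fin m)).card = 2 := Finset.card_pair hij.ne
  have : NeZero (t + 2 * ({i, j} : Finset (Fin m)).card) := ⟨by omega⟩
  have hB := ncard_isConfigOn_pair (κ := .diffZero) (q := t + 2 * ({i, j} : Finset (Fin m)).card)
    (by omega) hij
  refine ncard_restrictionComplement_shiC (κ := .diffZero) hij hq
    (by simp only at hB; omega) ?_ ?_ ?_
  · exact fun k hk => if_neg fun h => h.1.not_gt hk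
  · exact fun k hk hk' => if_pos ⟨hk, hk'⟩
  · exact fun k hk => if_neg fun h => h.2.not_gt hk

theorem ncard_restriction_diff_one (hij : i < j) (ht : 1 ≤ t) (hq : q = t + 2 * m) :
    (restrictionComplement (shiC m) (.diff i j 1) q).ncard =
      t * (t ^ (i : ℕ) * (t + 1) ^ ((j : ℕ) - i - 1) * t ^ (m - 1 - (j : ℕ))) := by
  have hcard : ({i, j} : Finset (Fin m)).card = 2 := Finset.card_pair hij.ne
  have : NeZero (t + 2 * ({i, j} : Finset (Fin m)).card) := ⟨by omega⟩
  have hB := ncard_isConfigOn_pair (κ := .diffOne) (q := t + 2 * ({i, j} : Finset (Fin m)).card)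
    (by omega) hij
  refine ncard_restrictionComplement_shiC (κ := .diffOne) (α := 0) (γ := 0) hij hq
    (by simp only at hB; omega) ?_ ?_ ?_
  · exact fun k hk => if_neg fun h => h.1.not_gt hk
  · exact fun k hk hk' => if_pos ⟨hk, hk'⟩
  · exact fun k hk => if_neg fun h => h.2.not_gt hk

theorem ncard_restriction_sum_zero (hij : i < j) (ht : 1 ≤ t) (hq : q = t + 2 * m) :
    (restrictionComplement (shiC m) (.sum i j 0) q).ncard =
      (if Odd q then t + 1 else t + 2) *
        ((t + 2) ^ (i : ℕ) * (t + 1) ^ ((j : ℕ) - i - 1) * t ^ (m - 1 - (j : ℕ))) := by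
  have hcard : ({i, j} : Finset (Fin m)).card = 2 := Finset.card_pair hij.ne
  have : NeZero (t + 2 * ({i, j} : Finset (Fin m)).card) := ⟨by omega⟩
  have hB := ncard_isConfigOn_pair (κ := .sumZero) (q := t + 2 * ({i, j} : Finset (Fin m)).card)
    (by omega) hij
  have hodd : Odd (t + 2 * ({i, j} : Finset (Fin m)).card) ↔ Odd q := by
    rw [Nat.odd_iff, Nat.odd_iff]; omega
  refine ncard_restrictionComplement_shiC (κ := .sumZero) (α := 2) (β := 1) (γ := 0) hij.le hq
    (by simp only [hodd] at hB; split_ifs at hB ⊢ <;> omega) ?_ ?_ ?_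
  · intro k hk
    rw [slotExcess_sumZero_of_ne hij.ne, if_pos hk, if_pos (hk.trans hij)]
  · intro k hk hk'
    rw [slotExcess_sumZero_of_ne hij.ne, if_neg hk.not_gt, if_pos hk']
  · intro k hk
    rw [slotExcess_sumZero_of_ne hij.ne, if_neg (hij.trans hk).not_gt, if_neg hk.not_gt]

theorem ncard_restriction_sum_one (hij : i < j) (ht : 1 ≤ t) (hq : q = t + 2 * m) :
    (restrictionComplement (shiC m) (.sum i j 1) q).ncard =
      (if Odd q then t + 1 else t) *
        (t ^ (i : ℕ) * (t + 1) ^ ((j : ℕ) - i - 1) * (t + 2) ^ (m - 1 - (j : ℕ))) := by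
  have hcard : ({i, j} : Finset (Fin m)).card = 2 := Finset.card_pair hij.ne
  have : NeZero (t + 2 * ({i, j} : Finset (Fin m)).card) := ⟨by omega⟩
  have hB := ncard_isConfigOn_pair (κ := .sumOne) (q := t + 2 * ({i, j} : Finset (Fin m)).card)
    (by omega) hij
  have hodd : Odd (t + 2 * ({i, j} : Finset (Fin m)).card) ↔ Odd q := by
    rw [Nat.odd_iff, Nat.odd_iff]; omega
  refine ncard_restrictionComplement_shiC (κ := .sumOne) (α := 0) (β := 1) (γ := 2) hij.le hq
    (by simp only [hodd] at hB; split_ifs at hB ⊢ <;> omega) ?_ ?_ ?_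
  · intro k hk
    rw [slotExcess_sumOne_of_ne hij.ne, if_neg hk.not_gt, if_neg (hk.trans hij).not_gt]
  · intro k hk hk'
    rw [slotExcess_sumOne_of_ne hij.ne, if_pos hk, if_neg hk'.not_gt]
  · intro k hk
    rw [slotExcess_sumOne_of_ne hij.ne, if_pos (hij.trans hk), if_pos hk]

theorem eventually_exists_eq_add_two_mul {T : ℕ → ℤ} (hT : ∀ q : ℕ, T q = (q : ℤ) - 2 * (m : ℤ)) :
    ∀ᶠ q : ℕ in atTop, ∃ t : ℕ, 1 ≤ t ∧ q = t + 2 * m ∧ T q = t := by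
  filter_upwards [eventually_ge_atTop (2 * m + 1)] with q hq
  refine ⟨q - 2 * m, by omega, by omega, ?_⟩
  rw [hT]
  omega

end Restrictions

theorem theorem1p5 (m : ℕ) (T : ℕ → ℤ) (hT : ∀ q : ℕ, T q = (q : ℤ) - 2 * (m : ℤ)) :
    (∀ i : Fin m,
      IsRestrictionCharQuasiPolynomial (shiC m) (.double i 0) 2 (fun q =>
        if Odd q then T q ^ (m - label i) * (T q + 1) ^ (label i - 1)
        else 2 * T q ^ (m - label i) * (T q + 1) ^ (label i - 1)) ∧
      IsRestrictionCharQuasiPolynomial (shiC m) (.double i 1) 2 (fun q =>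
        if Odd q then T q ^ (label i - 1) * (T q + 1) ^ (m - label i)
        else 0)) ∧
    (∀ i j : Fin m, i < j →
      IsRestrictionCharQuasiPolynomial (shiC m) (.diff i j 0) 1 (fun q =>
        (T q + 1) ^ (label j - label i - 1) * (T q + 2) ^ (m - label j + label i)) ∧
      IsRestrictionCharQuasiPolynomial (shiC m) (.diff i j 1) 1 (fun q =>
        T q ^ (m - label j + label i) * (T q + 1) ^ (label j - label i - 1)) ∧
      IsRestrictionCharQuasiPolynomial (shiC m) (.sum i j 0) 2 (fun q =>
        if Odd q then
          T q ^ (m - label j) * (T q + 1) ^ (label j - label i) * (T q + 2) ^ (label i - 1)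
        else
          T q ^ (m - label j) * (T q + 1) ^ (label j - label i - 1) * (T q + 2) ^ label i) ∧
      IsRestrictionCharQuasiPolynomial (shiC m) (.sum i j 1) 2 (fun q =>
        if Odd q then
          T q ^ (label i - 1) * (T q + 1) ^ (label j - label i) * (T q + 2) ^ (m - label j)
        else
          T q ^ label i * (T q + 1) ^ (label j - label i - 1) * (T q + 2) ^ (m - label j))) := by
  have hτ : ∀ q : ℕ, (Polynomial.X - 2 * (m : Polynomial ℤ)).eval (q : ℤ) = T q := by
    intro q
    simp [hT]
  have hlabel : ∀ i : Fin m, label i - 1 = i ∧ m - label i = m - 1 - i := by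
    intro i
    simp only [label]
    omega
  refine ⟨fun i => ?_, fun i j hij => ?_⟩
  · simp only [hlabel]
    refine ⟨⟨?_, ?_⟩, ?_, ?_⟩
    · refine isQuasiPolynomial_two
        ((.X - 2 * (m : Polynomial ℤ)) ^ (m - 1 - (i : ℕ)) *
          (.X - 2 * (m : Polynomial ℤ) + 1) ^ (i : ℕ))
        (2 * (.X - 2 * (m : Polynomial ℤ)) ^ (m - 1 - (i : ℕ)) *
          (.X - 2 * (m : Polynomial ℤ) + 1) ^ (i : ℕ)) fun q => ?_
      simp only [Polynomial.eval_mul, Polynomial.eval_pow, Polynomial.eval_add, hτ,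
        Polynomial.eval_one, Polynomial.eval_ofNat]
    · filter_upwards [eventually_exists_eq_add_two_mul hT] with q ⟨t, ht, hq, hTq⟩
      rw [ncard_restriction_double_zero hq, hTq]
      split_ifs <;> push_cast <;> ring
    · refine isQuasiPolynomial_two
        ((.X - 2 * (m : Polynomial ℤ)) ^ (i : ℕ) *
          (.X - 2 * (m : Polynomial ℤ) + 1) ^ (m - 1 - (i : ℕ))) 0 fun q => ?_
      simp only [Polynomial.eval_mul, Polynomial.eval_pow, Polynomial.eval_add, hτ,
        Polynomial.eval_one, Polynomial.eval_zero]
    · filter_upwards [eventually_exists_eq_add_two_mul hT] with q ⟨t, ht, hq, hTq⟩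
      rw [ncard_restriction_double_one hq, hTq]
      split_ifs <;> push_cast <;> ring
  · have hsub : label j - label i = (j - i - 1 : ℕ) + 1 := by
      simp only [label]
      omega
    have hi : label i = i + 1 := rfl
    simp only [hsub, hlabel, Nat.add_sub_cancel]
    simp only [hi]
    refine ⟨⟨?_, ?_⟩, ⟨?_, ?_⟩, ⟨?_, ?_⟩, ?_, ?_⟩
    · refine isQuasiPolynomial_one
        ((.X - 2 * (m : Polynomial ℤ) + 1) ^ ((j : ℕ) - i - 1) *
          (.X - 2 * (m : Polynomial ℤ) + 2) ^ (m - 1 - (j : ℕ) + ((i : ℕ) + 1))) fun q => ?_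
      simp only [Polynomial.eval_mul, Polynomial.eval_pow, Polynomial.eval_add, hτ,
        Polynomial.eval_one, Polynomial.eval_ofNat]
    · filter_upwards [eventually_exists_eq_add_two_mul hT] with q ⟨t, ht, hq, hTq⟩
      rw [ncard_restriction_diff_zero hij ht hq, hTq]
      push_cast
      ring
    · refine isQuasiPolynomial_one
        ((.X - 2 * (m : Polynomial ℤ)) ^ (m - 1 - (j : ℕ) + ((i : ℕ) + 1)) *
          (.X - 2 * (m : Polynomial ℤ) + 1) ^ ((j : ℕ) - i - 1)) fun q => ?_
      simp only [Polynomial.eval_mul, Polynomial.eval_pow, Polynomial.eval_add, hτ,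
        Polynomial.eval_one]
    · filter_upwards [eventually_exists_eq_add_two_mul hT] with q ⟨t, ht, hq, hTq⟩
      rw [ncard_restriction_diff_one hij ht hq, hTq]
      push_cast
      ring
    · refine isQuasiPolynomial_two
        ((.X - 2 * (m : Polynomial ℤ)) ^ (m - 1 - (j : ℕ)) *
          (.X - 2 * (m : Polynomial ℤ) + 1) ^ ((j : ℕ) - i - 1 + 1) *
          (.X - 2 * (m : Polynomial ℤ) + 2) ^ (i : ℕ))
        ((.X - 2 * (m : Polynomial ℤ)) ^ (m - 1 - (j : ℕ)) *
          (.X - 2 * (m : Polynomial ℤ) + 1) ^ ((j : ℕ) - i - 1) *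
          (.X - 2 * (m : Polynomial ℤ) + 2) ^ ((i : ℕ) + 1)) fun q => ?_
      simp only [Polynomial.eval_mul, Polynomial.eval_pow, Polynomial.eval_add, hτ,
        Polynomial.eval_one, Polynomial.eval_ofNat]
    · filter_upwards [eventually_exists_eq_add_two_mul hT] with q ⟨t, ht, hq, hTq⟩
      rw [ncard_restriction_sum_zero hij ht hq, hTq]
      split_ifs <;> push_cast <;> ring
    · refine isQuasiPolynomial_two
        ((.X - 2 * (m : Polynomial ℤ)) ^ (i : ℕ) *
          (.X - 2 * (m : Polynomial ℤ) + 1) ^ ((j : ℕ) - i - 1 + 1) *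
          (.X - 2 * (m : Polynomial ℤ) + 2) ^ (m - 1 - (j : ℕ)))
        ((.X - 2 * (m : Polynomial ℤ)) ^ ((i : ℕ) + 1) *
          (.X - 2 * (m : Polynomial ℤ) + 1) ^ ((j : ℕ) - i - 1) *
          (.X - 2 * (m : Polynomial ℤ) + 2) ^ (m - 1 - (j : ℕ))) fun q => ?_
      simp only [Polynomial.eval_mul, Polynomial.eval_pow, Polynomial.eval_add, hτ,
        Polynomial.eval_one, Polynomial.eval_ofNat]
    · filter_upwards [eventually_exists_eq_add_two_mul hT] with q ⟨t, ht, hq, hTq⟩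
      rw [ncard_restriction_sum_one hij ht hq, hTq]
      split_ifs <;> push_cast <;> ring
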